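/- All graphs are finite, simple and undirected. Write $G\to(A,B)$ if for every colouring of the edges of $G$ with two colours, the spanning subgraph formed by the edges of the first colour contains a copy of $A$ or the spanning subgraph formed by the edges of the second colour contains a copy of $B$. Let $R(A,B)$ be the smallest positive integer $n$ with $K_n\to(A,B)$, and let $\hat R(A,B)$ be the smallest number of edges of a graph $G$ with $G\to(A,B)$. For a forest $F$ with at least one vertex, let $n(F)$ be the number of vertices of a largest component of $F$, let $k_i(F)$ be the number of components of $F$ with exactly $i$ vertices, and let $C(F)=\{i : k_i(F)\neq 0\}$. For an integer $m\ge 3$ let $j_0=j_0(F,m)$ be the smallest $j\in C(F)$ at which $$\max_{j\in C(F)}\Big\{(j-1)(m-2)+\sum_{i=j}^{n(F)} i\,k_i(F)\Big\}$$ is attained. (a) For every forest $F$ with at least one vertex and every $m\ge 3$, $$\hat R(F,K_m)\le \binom{R(F,K_m)}{2}-(j_0-2).$$ (b) For the matching $tK_2$ ($t$ disjoint edges) with $t\ge 1$, and every $m\ge 3$, one has $j_0(tK_2,m)=2$ and $R(tK_2,K_m)=m+2t-2$, and hence $\hat R(tK_2,K_m)\le\binom{m+2t-2}{2}$. (c)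 If $t\ge 1$ and $m\ge 4t-1$, then $\hat R(tK_2,K_m)=\binom{m+2t-2}{2}$; that is, equality holds in (a) for $F=tK_2$. -/

import Mathlib

open SimpleGraph

noncomputable section

namespace ForestRamsey

/-- `G → (A, B)`: in every colouring of the edges of `G` with two colours (`false` is the first
colour, `true` the second) the spanning subgraph of the first colour contains a copy of `A`, or
the spanning subgraph of the second colour contains a copy of `B`. -/
def Arrows {U V W : Type*} (G : SimpleGraph U) (A : SimpleGraph V) (B : SimpleGraph W) : Prop :=
  ∀ c : G.EdgeLabeling Bool,
    A.IsContained (c.labelGraph false) ∨ B.IsContained (c.labelGraph true)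

/-- The Ramsey number `R(A, B)`: the smallest positive integer `n` with `K_n → (A, B)`. -/
def ramseyNumber {V W : Type*} (A : SimpleGraph V) (B : SimpleGraph W) : ℕ :=
  sInf {n : ℕ | 0 < n ∧ Arrows (completeGraph (Fin n)) A B}

/-- The size Ramsey number: the smallest number of edges of a finite graph `G` with
`G → (A, B)`. -/
def sizeRamseyNumber {V W : Type*} (A : SimpleGraph V) (B : SimpleGraph W) : ℕ :=
  sInf {e : ℕ | ∃ (n : ℕ) (G : SimpleGraph (Fin n)), G.edgeSet.ncard = e ∧ Arrows G A B}

/-- `k_i(F)`: the number of connected components of `F` with exactly `i` vertices. -/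
def numComponents {V : Type*} (F : SimpleGraph V) (i : ℕ) : ℕ :=
  {K : F.ConnectedComponent | K.supp.ncard = i}.ncard

/-- `n(F)`: the number of vertices of a largest component of `F`. -/
def largestOrder {V : Type*} (F : SimpleGraph V) : ℕ :=
  ⨆ K : F.ConnectedComponent, K.supp.ncard

/-- `C(F)`: the set of all `i` with `k_i(F) ≠ 0`. -/
def componentOrders {V : Type*} (F : SimpleGraph V) : Set ℕ :=
  {i : ℕ | numComponents F i ≠ 0}

/-- `(j - 1)(m - 2) + ∑_{i = j}^{n(F)} i k_i(F)`, as an integer. -/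
def forestValue {V : Type*} (F : SimpleGraph V) (m j : ℕ) : ℤ :=
  ((j : ℤ) - 1) * ((m : ℤ) - 2) +
    ∑ i ∈ Finset.Icc j (largestOrder F), (i : ℤ) * (numComponents F i : ℤ)

/-- The set of all `j ∈ C(F)` at which `forestValue F m` attains its maximum over `C(F)`. -/
def maximizers {V : Type*} (F : SimpleGraph V) (m : ℕ) : Set ℕ :=
  {j : ℕ | j ∈ componentOrders F ∧
    ∀ i ∈ componentOrders F, forestValue F m i ≤ forestValue F m j}

/-- `j_0`: the smallest `j ∈ C(F)` at which the maximum is attained. -/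
def jZero {V : Type*} (F : SimpleGraph V) (m : ℕ) : ℕ :=
  sInf (maximizers F m)

/-- `j_0` exists for every finite graph with at least one vertex, so the infimum in its
definition is a genuine minimum. -/
theorem jZero_isLeast {V : Type*} [Finite V] [Nonempty V] (F : SimpleGraph V) (m : ℕ) :
    IsLeast (maximizers F m) (jZero F m) := by
  have hfinite : (componentOrders F).Finite := by
    refine (Set.finite_range fun K : F.ConnectedComponent => K.supp.ncard).subset ?_
    intro i hi
    obtain ⟨K, hK⟩ := Set.nonempty_of_ncard_ne_zero hi
    exact ⟨K, hK⟩
  have hnonempty : (componentOrders F).Nonempty := by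
    obtain ⟨v⟩ := ‹Nonempty V›
    refine ⟨(F.connectedComponentMk v).supp.ncard, ?_⟩
    exact Set.ncard_ne_zero_of_mem (a := F.connectedComponentMk v) rfl
  obtain ⟨j, hj, hmax⟩ := Set.exists_max_image _ (forestValue F m) hfinite hnonempty
  have hne : (maximizers F m).Nonempty := ⟨j, hj, hmax⟩
  exact ⟨Nat.sInf_mem hne, fun _ hi => Nat.sInf_le hi⟩

/-- The matching `t K_2`: `t` disjoint edges, the `i`-th one joining `(i, false)` and
`(i, true)`. -/
def matchingGraph (t : ℕ) : SimpleGraph (Fin t × Bool) where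
  Adj x y := x.1 = y.1 ∧ x.2 ≠ y.2
  symm := ⟨fun _ _ h => ⟨h.1.symm, h.2.symm⟩⟩
  loopless := ⟨fun _ h => h.2 rfl⟩

end ForestRamsey

end

/-! Call the first colour red and the second blue. For a tree on n vertices against a clique, induct
on the clique order: a vertex with many blue neighbours reduces the problem to its blue
neighbourhood; otherwise red degrees are large enough to grow the tree greedily. One defective
vertex v, missing at most n - 2 edges, is harmless: it hosts a leaf, so it needs only one red
neighbour (`exists_tree_or_clique`).

A forest is embedded component by component, largest first (`exists_forest_embedding`). Let N be the
maximum defining j₀. A star of j₀ - 2 edges at v can be deleted from K_N: components with at least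
j₀ vertices tolerate the defect, and since j₀ is the smallest maximiser, the smaller ones make do
with N - 1 vertices, so v can be discarded. A colouring with disjoint red cliques shows that fewer
than N vertices never suffice (`not_arrows_of_card_lt`). Hence R(F, K_m) = N, and the deleted star
gives (a); (b) is the case where all components have two vertices.

For the lower bound in (c), peel off maximal independent sets with at least two vertices. Each costs
at most one in the clique order, and every remaining vertex sends an edge into the removed set.
Either a complete graph is reached, and the binomial coefficient results, or the peeling continues
down to K_2, and each layer of at least two vertices forces so many edges that the count is at least
as large (`edge_bound_of_arrows_matchingGraph`). -/

noncomputable section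

namespace ForestRamsey

/-! ### Trees versus cliques, with one defective vertex -/

section Trees

variable {V U : Type*}

/-- In an acyclic graph, a vertex outside a connected vertex set has at most one neighbour
in that set. -/
theorem eq_of_adj_of_preconnected_induce {T : SimpleGraph V} (hT : T.IsAcyclic) {A : Set V}
    (hA : (T.induce A).Preconnected) {a a' b : V} (ha : a ∈ A) (ha' : a' ∈ A) (hb : b ∉ A)
    (h : T.Adj a b) (h' : T.Adj a' b) : a = a' := by
  by_contra hne
  obtain ⟨p, hp⟩ := hA.exists_isPath ⟨a, ha⟩ ⟨a', ha'⟩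
  have hp' : (p.map (Embedding.induce A).toHom).IsPath :=
    hp.map Subtype.val_injective
  have hq : (Walk.cons h (Walk.cons h'.symm Walk.nil)).IsPath := by
    simp [Walk.cons_isPath_iff, h.ne, h'.ne', hne]
  have heq : p.map (Embedding.induce A).toHom = Walk.cons h (Walk.cons h'.symm Walk.nil) :=
    congrArg Subtype.val ((hT.subsingleton_path a a').elim ⟨_, hp'⟩ ⟨_, hq⟩)
  have hmem : b ∈ (p.map (Embedding.induce A).toHom).support := by
    rw [heq]
    simp
  rw [Walk.support_map, List.mem_map] at hmem
  obtain ⟨x, -, rfl⟩ := hmem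
  exact hb x.2

theorem preconnected_induce_insert {T : SimpleGraph V} {A : Set V}
    (hA : (T.induce A).Preconnected) {a b : V} (ha : a ∈ A) (h : T.Adj a b) :
    (T.induce (insert b A)).Preconnected := by
  have := (induce_union_connected hA (induce_pair_connected_of_adj h).preconnected
    ⟨a, ha, by simp⟩).preconnected
  have hset : insert b A = A ∪ {a, b} := by
    ext x
    simp only [Set.mem_insert_iff, Set.mem_union, Set.mem_singleton_iff]
    constructor
    · tauto
    · rintro (h | rfl | h)
      exacts [Or.inr h, Or.inr ha, Or.inl h]
  rwa [hset]

/-- A finite tree with a leaf `l` attached to `b` embeds into `R` with `l` going to `v`, provided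
`v` has a neighbour in a set `S` inside which all degrees are at least `|V| - 2`. -/
theorem exists_tree_embedding_of_leaf [Fintype V] {T : SimpleGraph V} (hT : T.IsTree)
    {l b : V} (hlb : T.Adj l b) (hl : ∀ x, T.Adj l x → x = b) (R : SimpleGraph U)
    {S : Finset U} {v w : U} (hv : v ∉ S) (hw : w ∈ S) (hvw : R.Adj v w)
    (hdeg : ∀ x ∈ S, Fintype.card V - 2 ≤ {y ∈ (S : Set U) | R.Adj x y}.ncard) :
    ∃ f : V → U, Function.Injective f ∧ (∀ x y, T.Adj x y → R.Adj (f x) (f y)) ∧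
      ∀ x, f x = v ∨ f x ∈ S := by
  classical
  -- Grow a connected piece `A` of the tree from the edge `l b`, one vertex at a time. By acyclicity
  -- a new vertex has just one neighbour in `A`, so only one red edge is required.
  have key : ∀ k, k + 2 ≤ Fintype.card V → ∃ A : Finset V, A.card = k + 2 ∧ l ∈ A ∧ b ∈ A ∧
      (T.induce (A : Set V)).Preconnected ∧ ∃ f : V → U, Set.InjOn f A ∧
        (∀ x ∈ A, ∀ y ∈ A, T.Adj x y → R.Adj (f x) (f y)) ∧ f l = v ∧
        ∀ x ∈ A, x ≠ l → f x ∈ S := by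
    intro k
    induction k with
    | zero =>
      intro _
      refine ⟨{l, b}, Finset.card_pair hlb.ne, by simp, by simp, ?_,
        fun x => if x = l then v else w, ?_, ?_, by simp, ?_⟩
      · rw [Finset.coe_pair]
        exact (induce_pair_connected_of_adj hlb).preconnected
      · intro x hx y hy hxy
        simp only [Finset.coe_insert, Finset.coe_singleton, Set.mem_insert_iff,
          Set.mem_singleton_iff] at hx hy
        rcases hx with rfl | rfl <;> rcases hy with rfl | rfl <;>
          simp_all [hlb.ne', hvw.ne, hvw.ne']
      · intro x hx y hy hxy
        simp only [Finset.mem_insert, Finset.mem_singleton] at hx hy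
        rcases hx with rfl | rfl <;> rcases hy with rfl | rfl
        · exact (hxy.ne rfl).elim
        · simpa [hlb.ne'] using hvw
        · simpa [hlb.ne'] using hvw.symm
        · exact (hxy.ne rfl).elim
      · intro x _ hxl
        simpa [hxl] using hw
    | succ k ih =>
      intro hk
      obtain ⟨A, hAc, hlA, hbA, hA, f, hinj, hf, hfl, hfS⟩ := ih (by omega)
      obtain ⟨c', hc'⟩ : ∃ c, c ∉ A := by
        by_contra! hall
        have : A = Finset.univ := Finset.eq_univ_iff_forall.2 hall
        rw [this, Finset.card_univ] at hAc
        omega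
      obtain ⟨p⟩ := hT.connected.preconnected l c'
      obtain ⟨⟨⟨a, c⟩, hac⟩, -, haA, hcA⟩ := p.exists_boundary_dart (A : Set V) hlA hc'
      simp only [Finset.mem_coe] at haA hcA
      change T.Adj a c at hac
      have hal : a ≠ l := by
        rintro rfl
        exact hcA (hl c hac ▸ hbA)
      -- Of the `k + 2` used positions at most `k` can block: `f l = v` is outside `S`, and `f a` is
      -- not its own neighbour. As `k + 3 ≤ |V|`, a neighbour is free.
      obtain ⟨y, ⟨hyS, hay⟩, hy⟩ : ∃ y ∈ {y ∈ (S : Set U) | R.Adj (f a) y},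
          y ∉ (((A.erase l).erase a).image f : Set U) := by
        apply Set.exists_mem_notMem_of_ncard_lt_ncard
        refine lt_of_lt_of_le ?_ (hdeg (f a) (hfS a haA hal))
        have h1 : (((A.erase l).erase a).image f : Set U).ncard ≤ k := by
          rw [Set.ncard_coe_finset]
          refine Finset.card_image_le.trans ?_
          rw [Finset.card_erase_of_mem (by simp [hal, haA]), Finset.card_erase_of_mem hlA, hAc]
          simp
        · omega
        · exact Finset.finite_toSet _
      have hyA : ∀ x ∈ A, f x ≠ y := by
        rintro x hx rfl
        by_cases hxl : x = l
        · subst hxl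
          rw [hfl] at hyS
          exact hv hyS
        · by_cases hxa : x = a
          · subst hxa
            exact hay.ne rfl
          · exact hy (Finset.mem_coe.2 (Finset.mem_image_of_mem f (by simp [hxl, hxa, hx])))
      have hne : ∀ x ∈ A, x ≠ c := by
        rintro x hx rfl
        exact hcA hx
      refine ⟨insert c A, by rw [Finset.card_insert_of_notMem hcA, hAc],
        Finset.mem_insert_of_mem hlA, Finset.mem_insert_of_mem hbA, ?_,
        Function.update f c y, ?_, ?_, ?_, ?_⟩
      · rw [Finset.coe_insert]
        exact preconnected_induce_insert hA haA hac
      · intro x hx z hz hxz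
        simp only [Finset.coe_insert, Set.mem_insert_iff, Finset.mem_coe] at hx hz
        rcases hx with rfl | hx <;> rcases hz with rfl | hz
        · rfl
        · simp only [Function.update_self, Function.update_of_ne (hne z hz)] at hxz
          exact (hyA z hz hxz.symm).elim
        · simp only [Function.update_self, Function.update_of_ne (hne x hx)] at hxz
          exact (hyA x hx hxz).elim
        · simp only [Function.update_of_ne (hne z hz), Function.update_of_ne (hne x hx)] at hxz
          exact hinj hx hz hxz
      · intro x hx z hz hxz
        simp only [Finset.mem_insert] at hx hz
        rcases hx with rfl | hx <;> rcases hz with rfl | hz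
        · exact (hxz.ne rfl).elim
        · have := eq_of_adj_of_preconnected_induce hT.isAcyclic hA haA hz hcA hac hxz.symm
          subst this
          simpa [Function.update_of_ne (hne _ hz)] using hay.symm
        · have := eq_of_adj_of_preconnected_induce hT.isAcyclic hA haA hx hcA hac hxz
          subst this
          simpa [Function.update_of_ne (hne _ hx)] using hay
        · simpa [Function.update_of_ne (hne _ hx), Function.update_of_ne (hne _ hz)] using
            hf x hx z hz hxz
      · rw [Function.update_of_ne (hne l hlA), hfl]
      · intro x hx hxl
        rcases Finset.mem_insert.1 hx with rfl | hx
        · simpa using hyS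
        · simpa [Function.update_of_ne (hne x hx)] using hfS x hx hxl
  have h2 : 2 ≤ Fintype.card V := by
    simpa [Finset.card_pair hlb.ne] using Finset.card_le_univ ({l, b} : Finset V)
  obtain ⟨A, hAc, -, -, -, f, hinj, hf, hfl, hfS⟩ := key (Fintype.card V - 2) (by omega)
  have hA : A = Finset.univ := Finset.eq_univ_of_card A (by omega)
  subst hA
  refine ⟨f, fun x y h => hinj (by simp) (by simp) h,
    fun x y => hf x (by simp) y (by simp), fun x => ?_⟩
  by_cases hx : x = l
  · exact Or.inl (hx ▸ hfl)
  · exact Or.inr (hfS x (by simp) hx)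

/-- A two-coloured complete graph on `S`, except that up to `n - 2` edges at a single vertex `v`
may be missing, contains a red copy of any tree on `n` vertices or a blue `K_{m+1}`
as soon as `|S| > (n - 1) m`. -/
theorem exists_tree_or_clique [Fintype V] {T : SimpleGraph V} (hT : T.IsTree)
    (R B : SimpleGraph U) (m : ℕ) :
    ∀ (S : Finset U) (v : U), (Fintype.card V - 1) * m < S.card →
      (∀ x ∈ S, ∀ y ∈ S, x ≠ y → x ≠ v → y ≠ v → R.Adj x y ∨ B.Adj x y) →
      (v ∈ S → {x ∈ (S : Set U) | x ≠ v ∧ ¬ R.Adj v x ∧ ¬ B.Adj v x}.ncard ≤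
        Fintype.card V - 2) →
      (∃ f : V → U, Function.Injective f ∧ (∀ x y, T.Adj x y → R.Adj (f x) (f y)) ∧
        ∀ x, f x ∈ S) ∨
      ∃ Q ⊆ S, B.IsNClique (m + 1) Q := by
  classical
  have hVne : Nonempty V := hT.connected.nonempty
  rcases subsingleton_or_nontrivial V with hV | hV
  · intro S _ hS _ _
    obtain ⟨x, hx⟩ : S.Nonempty := Finset.card_pos.1 (by omega)
    exact Or.inl ⟨fun _ => x, Function.injective_of_subsingleton _,
      fun a b h => (h.ne (Subsingleton.elim a b)).elim, fun _ => hx⟩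
  have hn : 2 ≤ Fintype.card V := Fintype.one_lt_card
  obtain ⟨l, hl⟩ := hT.exists_vert_degree_one_of_nontrivial
  obtain ⟨b, hb, hbu⟩ := degree_eq_one_iff_existsUnique_adj.1 hl
  induction m with
  | zero =>
    intro S v hS _ _
    obtain ⟨x, hx⟩ : S.Nonempty := Finset.card_pos.1 (by omega)
    exact Or.inr ⟨{x}, by simpa using hx, by simp [isNClique_iff]⟩
  | succ m ih =>
    intro S v hS hcol hmiss
    by_cases hbig : ∃ x ∈ S, (Fintype.card V - 1) * m < (S.filter (B.Adj x)).card
    · obtain ⟨x, hx, hbig⟩ := hbig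
      rcases ih (S.filter (B.Adj x)) v hbig
        (fun y hy z hz => hcol y (Finset.mem_of_mem_filter _ hy) z (Finset.mem_of_mem_filter _ hz))
        (fun hv => (Set.ncard_le_ncard (t := {x ∈ (S : Set U) | x ≠ v ∧ ¬ R.Adj v x ∧ ¬ B.Adj v x})
          (fun y hy => ⟨Finset.mem_of_mem_filter _ hy.1, hy.2⟩)
          (S.finite_toSet.subset fun y hy => hy.1)).trans (hmiss (Finset.mem_of_mem_filter _ hv))) with
        ⟨f, h1, h2, h3⟩ | ⟨Q, hQ, hQc⟩
      · exact Or.inl ⟨f, h1, h2, fun x => Finset.mem_of_mem_filter _ (h3 x)⟩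
      · refine Or.inr ⟨insert x Q, Finset.insert_subset hx (hQ.trans (Finset.filter_subset _ _)),
          hQc.insert fun y hy => (Finset.mem_filter.1 (hQ hy)).2⟩
    push Not at hbig
    left
    obtain ⟨v, hvS, hcol, hmiss⟩ : ∃ v ∈ S,
        (∀ x ∈ S, ∀ y ∈ S, x ≠ y → x ≠ v → y ≠ v → R.Adj x y ∨ B.Adj x y) ∧
        {x ∈ (S : Set U) | x ≠ v ∧ ¬ R.Adj v x ∧ ¬ B.Adj v x}.ncard ≤ Fintype.card V - 2 := by
      by_cases hvS : v ∈ S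
      · exact ⟨v, hvS, hcol, hmiss hvS⟩
      -- Without `v` nothing is missing, so any vertex of `S` can take its role.
      · obtain ⟨u, hu⟩ : S.Nonempty := Finset.card_pos.1 (by omega)
        have hne : ∀ x ∈ S, x ≠ v := by
          rintro x hx rfl
          exact hvS hx
        refine ⟨u, hu, fun x hx y hy hxy _ _ => hcol x hx y hy hxy (hne x hx) (hne y hy), ?_⟩
        rw [Set.ncard_eq_zero (S.finite_toSet.subset fun y hy => hy.1) |>.2]
        · simp
        · ext x
          simp only [Set.mem_ofPred_eq, Set.mem_empty_iff_false, iff_false]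
          rintro ⟨hx, hxu, h1, h2⟩
          rcases hcol u hu x hx hxu.symm (hne u hu) (hne x hx) with h | h
          exacts [h1 h, h2 h]
    obtain ⟨n, hn'⟩ : ∃ n, Fintype.card V = n + 2 := ⟨Fintype.card V - 2, by omega⟩
    simp only [hn', Nat.add_sub_cancel, show n + 2 - 1 = n + 1 by omega] at hS hbig hmiss
    have hmul : (n + 1) * (m + 1) = (n + 1) * m + n + 1 := by ring
    have hSv : (S.erase v).card + 1 = S.card := Finset.card_erase_add_one hvS
    -- The other vertices number at least `(n + 1) * m + n + 1`; at most `(n + 1) * m` are blue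
    -- neighbours of `v` and at most `n` are missing.
    obtain ⟨w, hw, hvw⟩ : ∃ w ∈ S.erase v, R.Adj v w := by
      by_contra! hno
      have hsub : S.erase v ⊆ S.filter (B.Adj v) ∪
          S.filter (fun x => x ≠ v ∧ ¬ R.Adj v x ∧ ¬ B.Adj v x) := by
        intro x hx
        have := hno x hx
        simp only [Finset.mem_erase] at hx
        simp only [Finset.mem_union, Finset.mem_filter]
        tauto
      have h1 := (Finset.card_le_card hsub).trans (Finset.card_union_le _ _)
      have h2 := hbig v hvS
      have h3 : (S.filter (fun x => x ≠ v ∧ ¬ R.Adj v x ∧ ¬ B.Adj v x)).card ≤ n := by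
        rw [← Set.ncard_coe_finset, Finset.coe_filter]
        exact hmiss
      omega
    -- A vertex of `S.erase v` has at least `(n + 1) * m + n` others there, at most `(n + 1) * m` of
    -- them blue, which leaves `n = |V| - 2` red neighbours.
    obtain ⟨f, h1, h2, h3⟩ := exists_tree_embedding_of_leaf hT hb hbu R
      (Finset.notMem_erase v S) hw hvw (by
        intro x hx
        have hsub : (S.erase v).erase x ⊆ S.filter (B.Adj x) ∪ (S.erase v).filter (R.Adj x) := by
          intro y hy
          simp only [Finset.mem_erase] at hx hy
          have := hcol x hx.2 y hy.2.2 hy.1.symm hx.1 hy.2.1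
          simp only [Finset.mem_union, Finset.mem_filter, Finset.mem_erase]
          tauto
        have h1 := (Finset.card_le_card hsub).trans (Finset.card_union_le _ _)
        have h2 := hbig x (Finset.mem_of_mem_erase hx)
        have h3 := Finset.card_erase_add_one hx
        have h4 : {y ∈ ((S.erase v : Finset U) : Set U) | R.Adj x y}.ncard =
            ((S.erase v).filter (R.Adj x)).card := by
          rw [← Set.ncard_coe_finset, Finset.coe_filter]
          rfl
        rw [h4, hn']
        omega)
    refine ⟨f, h1, h2, fun x => ?_⟩
    rcases h3 x with h | h
    · exact h ▸ hvS
    · exact Finset.mem_of_mem_erase h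

end Trees

/-! ### Embedding forests, largest component first -/

section Forests

variable {V U W : Type*}

open scoped Classical in
/-- The number of vertices needed to find, among the components in `𝒦`, those of at least the order
of `K`, in a red-blue complete graph without blue `K_{M+2}`. -/
def componentDemand (F : SimpleGraph V) (M : ℕ) (𝒦 : Finset F.ConnectedComponent)
    (K : F.ConnectedComponent) : ℕ :=
  (K.supp.ncard - 1) * M + ∑ L ∈ 𝒦 with K.supp.ncard ≤ L.supp.ncard, L.supp.ncard

-- Embedding a largest component uses up exactly as many vertices as it lowers every remaining
-- demand, so the size hypotheses survive the induction.
open scoped Classical in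
theorem componentDemand_erase {F : SimpleGraph V} {M : ℕ} {𝒦 : Finset F.ConnectedComponent}
    {K K' : F.ConnectedComponent} (hK : K ∈ 𝒦) (h : K'.supp.ncard ≤ K.supp.ncard) :
    componentDemand F M (𝒦.erase K) K' + K.supp.ncard = componentDemand F M 𝒦 K' := by
  unfold componentDemand
  rw [Finset.filter_erase, add_assoc, Finset.sum_erase_add _ _ (by simp [hK, h])]

theorem supp_ncard_pos [Finite V] {F : SimpleGraph V} (K : F.ConnectedComponent) :
    0 < K.supp.ncard :=
  (Set.ncard_pos (Set.toFinite _)).2 K.nonempty_supp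

-- Meeting the demand of `K` therefore leaves room to apply `exists_tree_or_clique` to `K` and a
-- blue clique on `M + 2` vertices.
open scoped Classical in
theorem mul_lt_componentDemand [Finite V] {F : SimpleGraph V} {M : ℕ}
    {𝒦 : Finset F.ConnectedComponent} {K : F.ConnectedComponent} (hK : K ∈ 𝒦) :
    (K.supp.ncard - 1) * (M + 1) < componentDemand F M 𝒦 K := by
  have h : K.supp.ncard ≤ ∑ L ∈ 𝒦 with K.supp.ncard ≤ L.supp.ncard, L.supp.ncard :=
    Finset.single_le_sum (f := fun L : F.ConnectedComponent => L.supp.ncard)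
      (fun _ _ => Nat.zero_le _) (by simp [hK])
  have := supp_ncard_pos K
  unfold componentDemand
  rw [mul_add, mul_one]
  omega

open scoped Classical in
/-- A forest can be embedded component by component, in order of decreasing size, into the red
graph of a two-coloured complete graph without blue `K_{M+2}`, even when up to `d` edges at one
vertex `v` are missing: that vertex is given up once the components have fewer than `d + 2`
vertices. -/
theorem exists_forest_embedding [Finite V] {F : SimpleGraph V} (hF : F.IsAcyclic)
    (R B : SimpleGraph U) (M d : ℕ) (v : U) (hB : B.CliqueFree (M + 2))
    (𝒦 : Finset F.ConnectedComponent) (S : Finset U)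
    (hcol : ∀ x ∈ S, ∀ y ∈ S, x ≠ y → x ≠ v → y ≠ v → R.Adj x y ∨ B.Adj x y)
    (hmiss : {x ∈ (S : Set U) | x ≠ v ∧ ¬ R.Adj v x ∧ ¬ B.Adj v x}.ncard ≤ d)
    (hS : ∀ K ∈ 𝒦, componentDemand F M 𝒦 K ≤ S.card)
    (hSv : ∀ K ∈ 𝒦, d ≤ K.supp.ncard - 2 ∨ componentDemand F M 𝒦 K ≤ (S.erase v).card) :
    ∃ f : V → U, Set.InjOn f {x | F.connectedComponentMk x ∈ 𝒦} ∧
      (∀ x y, F.connectedComponentMk x ∈ 𝒦 → F.Adj x y → R.Adj (f x) (f y)) ∧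
      ∀ x, F.connectedComponentMk x ∈ 𝒦 → f x ∈ S := by
  induction h𝒦 : 𝒦.card generalizing 𝒦 S with
  | zero =>
    rw [Finset.card_eq_zero] at h𝒦
    subst h𝒦
    exact ⟨fun _ => v, by simp, by simp, by simp⟩
  | succ k ih =>
    have hne : 𝒦.Nonempty := Finset.card_pos.1 (by omega)
    obtain ⟨K, hK, hmax⟩ := 𝒦.exists_max_image (fun K => K.supp.ncard) hne
    have : Fintype K := Fintype.ofFinite K
    have hcard : Fintype.card K = K.supp.ncard := by
      rw [← Nat.card_eq_fintype_card]
      rfl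
    obtain ⟨S₀, hS₀S, hS₀, hmiss₀, hS₀', hS₀v⟩ : ∃ S₀ ⊆ S,
        (K.supp.ncard - 1) * (M + 1) < S₀.card ∧
        (v ∈ S₀ → d ≤ K.supp.ncard - 2) ∧
        (∀ K' ∈ 𝒦, componentDemand F M 𝒦 K' ≤ S₀.card) ∧
        (∀ K' ∈ 𝒦, d ≤ K'.supp.ncard - 2 ∨
          componentDemand F M 𝒦 K' ≤ (S₀.erase v).card) := by
      -- If the largest remaining component cannot tolerate the defect at `v`, none of the others
      -- can, so all demands are met without `v`.
      by_cases hd : d ≤ K.supp.ncard - 2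
      · exact ⟨S, subset_rfl, (mul_lt_componentDemand hK).trans_le (hS K hK), fun _ => hd, hS, hSv⟩
      · have hall : ∀ K' ∈ 𝒦, componentDemand F M 𝒦 K' ≤ (S.erase v).card := by
          intro K' hK'
          rcases hSv K' hK' with h | h
          · have := hmax K' hK'
            omega
          · exact h
        refine ⟨S.erase v, Finset.erase_subset _ _,
          (mul_lt_componentDemand hK).trans_le (hall K hK), fun h => by simp at h, hall,
          fun K' hK' => Or.inr ?_⟩
        rw [Finset.erase_idem]
        exact hall K' hK'
    rcases exists_tree_or_clique (hF.isTree_connectedComponent K) R B (M + 1) S₀ v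
      (by rwa [hcard])
      (fun x hx y hy => hcol x (hS₀S hx) y (hS₀S hy))
      (fun hv => by
        rw [hcard]
        refine le_trans (le_trans ?_ hmiss) (hmiss₀ hv)
        exact Set.ncard_le_ncard (fun x hx => ⟨hS₀S hx.1, hx.2⟩)
          (S.finite_toSet.subset fun y hy => hy.1)) with
      ⟨g, hginj, hg, hgS⟩ | ⟨Q, -, hQ⟩
    swap
    · exact (hB Q hQ).elim
    set I : Finset U := Finset.univ.image g with hI
    have hIc : I.card = K.supp.ncard := by
      rw [hI, Finset.card_image_of_injective _ hginj, Finset.card_univ, hcard]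
    have hc1 : S₀.card ≤ (S₀ \ I).card + K.supp.ncard := by
      have := Finset.le_card_sdiff I S₀
      omega
    have hc2 : (S₀.erase v).card ≤ ((S₀ \ I).erase v).card + K.supp.ncard := by
      have h1 := Finset.le_card_sdiff I (S₀.erase v)
      have h2 : S₀.erase v \ I ⊆ (S₀ \ I).erase v := by
        intro x
        simp only [Finset.mem_sdiff, Finset.mem_erase]
        tauto
      have h3 := Finset.card_le_card h2
      omega
    have hsub : S₀ \ I ⊆ S := Finset.sdiff_subset.trans hS₀S
    obtain ⟨f, hfinj, hf, hfS⟩ := ih (𝒦.erase K) (S₀ \ I)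
      (fun x hx y hy => hcol x (hsub hx) y (hsub hy))
      (le_trans (Set.ncard_le_ncard
          (t := {x ∈ (S : Set U) | x ≠ v ∧ ¬ R.Adj v x ∧ ¬ B.Adj v x}) (fun x hx => ⟨hsub hx.1, hx.2⟩)
          (S.finite_toSet.subset fun y hy => hy.1)) hmiss)
      (fun K' hK' => by
        have hK'' := Finset.mem_of_mem_erase hK'
        have h1 := componentDemand_erase (M := M) hK (hmax K' hK'')
        have h2 := hS₀' K' hK''
        omega)
      (fun K' hK' => by
        have hK'' := Finset.mem_of_mem_erase hK'
        have h1 := componentDemand_erase (M := M) hK (hmax K' hK'')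
        refine (hS₀v K' hK'').imp_right fun h2 => ?_
        omega)
      (by rw [Finset.card_erase_of_mem hK, h𝒦]; rfl)
    have hgI : ∀ x, g x ∈ I := fun x => Finset.mem_image_of_mem g (Finset.mem_univ x)
    have hfI : ∀ x, F.connectedComponentMk x ∈ 𝒦 → F.connectedComponentMk x ≠ K → f x ∉ I :=
      fun x hx hxK => (Finset.mem_sdiff.1 (hfS x (Finset.mem_erase.2 ⟨hxK, hx⟩))).2
    refine ⟨fun x => if h : F.connectedComponentMk x = K then g ⟨x, h⟩ else f x, ?_, ?_, ?_⟩
    · intro x hx y hy hxy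
      simp only [Set.mem_ofPred_eq] at hx hy
      by_cases h1 : F.connectedComponentMk x = K <;> by_cases h2 : F.connectedComponentMk y = K <;>
        simp only [h1, h2, dite_true, dite_false] at hxy
      · exact congrArg Subtype.val (hginj hxy)
      · exact (hfI y hy h2 (hxy ▸ hgI _)).elim
      · exact (hfI x hx h1 (hxy ▸ hgI _)).elim
      · exact hfinj (Finset.mem_erase.2 ⟨h1, hx⟩) (Finset.mem_erase.2 ⟨h2, hy⟩) hxy
    · intro x y hx hxy
      have he := ConnectedComponent.connectedComponentMk_eq_of_adj hxy
      by_cases h1 : F.connectedComponentMk x = K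
      · have h2 : F.connectedComponentMk y = K := he ▸ h1
        simp only [h1, h2, dite_true]
        exact hg _ _ ((K.toSimpleGraph_adj h1 h2).2 hxy)
      · have h2 : F.connectedComponentMk y ≠ K := he ▸ h1
        simp only [h1, h2, dite_false]
        exact hf x y (Finset.mem_erase.2 ⟨h1, hx⟩) hxy
    · intro x hx
      by_cases h1 : F.connectedComponentMk x = K
      · simp only [h1, dite_true]
        exact hS₀S (hgS _)
      · simp only [h1, dite_false]
        exact hsub (hfS x (Finset.mem_erase.2 ⟨h1, hx⟩))

/-- The number of vertices lying in components with at least `j` vertices. -/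
def bigOrder (F : SimpleGraph V) (j : ℕ) : ℕ :=
  {x : V | j ≤ (F.connectedComponentMk x).supp.ncard}.ncard

open scoped Classical in
theorem sum_supp_ncard_eq_bigOrder [Finite V] (F : SimpleGraph V) [Fintype F.ConnectedComponent]
    (j : ℕ) :
    ∑ L : F.ConnectedComponent with j ≤ L.supp.ncard, L.supp.ncard = bigOrder F j := by
  have := Fintype.ofFinite V
  rw [bigOrder, Set.ncard_eq_toFinset_card', Finset.card_eq_sum_card_fiberwise
    (f := F.connectedComponentMk) (t := Finset.univ.filter fun L => j ≤ L.supp.ncard)]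
  · refine Finset.sum_congr rfl fun L hL => ?_
    rw [← Set.ncard_coe_finset]
    congr 1
    ext x
    simp only [Finset.mem_filter, Finset.mem_univ, true_and] at hL
    simp only [ConnectedComponent.mem_supp_iff, Finset.coe_filter, Set.mem_toFinset,
      Set.mem_ofPred_eq]
    constructor
    · rintro rfl
      exact ⟨hL, rfl⟩
    · exact fun h => h.2
  · intro x hx
    simpa using hx

open scoped Classical in
theorem forestValue_eq [Finite V] (F : SimpleGraph V) (M j : ℕ) (hj : 1 ≤ j) :
    forestValue F (M + 2) j = (((j - 1) * M + bigOrder F j : ℕ) : ℤ) := by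
  have : Fintype F.ConnectedComponent := Fintype.ofFinite _
  have hsum : ∑ i ∈ Finset.Icc j (largestOrder F), i * numComponents F i = bigOrder F j := by
    rw [← sum_supp_ncard_eq_bigOrder, ← Finset.sum_fiberwise_of_maps_to
      (t := Finset.Icc j (largestOrder F)) (g := fun L : F.ConnectedComponent => L.supp.ncard)]
    · refine Finset.sum_congr rfl fun i hi => ?_
      rw [Finset.sum_congr rfl (g := fun _ => i) (by simp), Finset.sum_const, smul_eq_mul,
        mul_comm, numComponents, ← Set.ncard_coe_finset]
      congr 2
      ext L
      simp only [Finset.mem_Icc] at hi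
      simp only [Set.mem_ofPred_eq, Finset.coe_filter, Finset.mem_filter, Finset.mem_univ,
        true_and]
      constructor
      · rintro rfl
        exact ⟨hi.1, rfl⟩
      · exact fun h => h.2
    · intro L hL
      simp only [Finset.mem_filter, Finset.mem_univ, true_and] at hL
      exact Finset.mem_Icc.2 ⟨hL, le_ciSup (f := fun K : F.ConnectedComponent => K.supp.ncard)
        (Set.finite_range _).bddAbove L⟩
  rw [forestValue, ← hsum]
  push_cast [Nat.cast_sub hj]
  ring

end Forests

/-! ### Ramsey numbers of forests and deleted stars -/

section Arrowing

variable {V U W : Type*}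

theorem arrows_iff {G : SimpleGraph U} {A : SimpleGraph V} {B : SimpleGraph W} :
    Arrows G A B ↔ ∀ R ≤ G, A.IsContained R ∨ B.IsContained (G \ R) := by
  classical
  constructor
  · intro h R hR
    refine (h fun e => decide (e.1 ∉ R.edgeSet)).imp (fun hA => hA.mono_right ?_)
      fun hB => hB.mono_right ?_
    · intro x y hxy
      obtain ⟨_, h⟩ := (EdgeLabeling.labelGraph_adj x y).1 hxy
      simpa using h
    · intro x y hxy
      obtain ⟨hG, h⟩ := (EdgeLabeling.labelGraph_adj x y).1 hxy
      exact ⟨hG, by simpa using h⟩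
  · intro h c
    refine (h (c.labelGraph false) c.labelGraph_le).imp_right fun hB => hB.mono_right ?_
    rintro x y ⟨hxy, hn⟩
    refine (EdgeLabeling.labelGraph_adj x y).2 ⟨hxy, ?_⟩
    by_contra hc
    exact hn ((EdgeLabeling.labelGraph_adj x y).2 ⟨hxy, by simpa using hc⟩)

theorem arrows_completeGraph_iff {G : SimpleGraph U} {A : SimpleGraph V} {m : ℕ} :
    Arrows G A (completeGraph (Fin m)) ↔
      ∀ R ≤ G, (G \ R).CliqueFree m → A.IsContained R := by
  rw [arrows_iff]
  refine forall₂_congr fun R _ => ?_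
  rw [← not_cliqueFree_iff_top_isContained]
  tauto

theorem Arrows.mono {G G' : SimpleGraph U} {A : SimpleGraph V} {m : ℕ} (hG : G ≤ G')
    (h : Arrows G A (completeGraph (Fin m))) : Arrows G' A (completeGraph (Fin m)) := by
  rw [arrows_completeGraph_iff] at h ⊢
  intro R hR hfree
  refine (h (R ⊓ G) inf_le_right (hfree.anti ?_)).mono_right inf_le_left
  rintro x y ⟨hxy, hn⟩
  exact ⟨hG hxy, fun hr => hn ⟨hr, hxy⟩⟩

/-- Colour edges inside the parts of a partition into one part of size `bigOrder F j - 1` and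
`M` parts of size `j - 1` red, all others blue. -/
theorem not_arrows_of_card_lt [Finite V] [Finite U] (F : SimpleGraph V) (G : SimpleGraph U)
    {M j : ℕ} (hpos : 0 < bigOrder F j) (hU : Nat.card U < (j - 1) * M + bigOrder F j) :
    ¬ Arrows G F (completeGraph (Fin (M + 2))) := by
  rw [arrows_completeGraph_iff]
  intro h
  obtain ⟨s, hs⟩ : ∃ s, bigOrder F j = s + 1 := ⟨bigOrder F j - 1, by omega⟩
  set e : U → ℕ := fun x => (Finite.equivFin U x : ℕ) with he
  have heinj : Function.Injective e :=
    Fin.val_injective.comp (Finite.equivFin U).injective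
  have helt : ∀ x, e x < Nat.card U := fun x => (Finite.equivFin U x).2
  -- Part 0 consists of the first `s` vertices; the rest are cut into consecutive blocks of length
  -- `j - 1`.
  set p : U → ℕ := fun x => if e x < s then 0 else 1 + (e x - s) / (j - 1) with hp
  have hpM : ∀ x, p x < M + 1 := by
    intro x
    simp only [hp]
    split_ifs with hx
    · omega
    · have h1 := helt x
      have h2 : e x - s < M * (j - 1) := by
        rw [mul_comm]
        omega
      have := Nat.div_lt_of_lt_mul (mul_comm M _ ▸ h2)
      omega
  have hpart : ∀ i, i ≠ 0 → {x | p x = i}.ncard ≤ j - 1 := by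
    intro i hi
    have hsub : e '' {x | p x = i} ⊆
        (Finset.Ico (s + (i - 1) * (j - 1)) (s + (i - 1) * (j - 1) + (j - 1)) : Finset ℕ) := by
      rintro _ ⟨x, hx, rfl⟩
      simp only [hp, Set.mem_ofPred_eq] at hx
      split_ifs at hx with hxs
      · omega
      -- If `j - 1 = 0`, then `U` has at most `s` vertices and all lie in part 0.
      · have hj : 0 < j - 1 := by
          rcases Nat.eq_zero_or_pos (j - 1) with h0 | h0
          · have := helt x
            rw [h0, zero_mul] at hU
            omega
          · exact h0
        have hi' : (e x - s) / (j - 1) = i - 1 := by omega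
        have h1 := Nat.div_mul_le_self (e x - s) (j - 1)
        have h2 := Nat.lt_div_mul_add (a := e x - s) hj
        rw [hi'] at h1 h2
        simp only [Finset.coe_Ico, Set.mem_Ico]
        omega
    have h1 := Set.ncard_le_ncard hsub (Finset.finite_toSet _)
    rw [Set.ncard_image_of_injective _ heinj, Set.ncard_coe_finset, Nat.card_Ico] at h1
    omega
  let R : SimpleGraph U :=
    { Adj := fun x y => G.Adj x y ∧ p x = p y
      symm := ⟨fun _ _ h => ⟨h.1.symm, h.2.symm⟩⟩
      loopless := ⟨fun _ h => h.1.ne rfl⟩ }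
  have hcolor : (G \ R).Colorable (M + 1) :=
    ⟨Coloring.mk (fun x => ⟨p x, hpM x⟩) (by
      rintro x y ⟨hxy, hn⟩ heq
      exact hn ⟨hxy, by simpa using heq⟩)⟩
  obtain ⟨f⟩ := h R (fun _ _ h => h.1) (hcolor.cliqueFree (by omega))
  have hfinj : Function.Injective f := f.injective
  have hconst : ∀ x y, F.Reachable x y → p (f x) = p (f y) := by
    rintro x y ⟨w⟩
    induction w with
    | nil => rfl
    | cons hxy _ ih => exact (f.toHom.map_adj hxy).2.trans ih
  -- A red component stays in one part, and at least `j` vertices do not fit into a part of size `j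
  -- - 1`.
  have hzero : ∀ x, j ≤ (F.connectedComponentMk x).supp.ncard → e (f x) < s := by
    intro x hx
    by_contra hxs
    have hne : p (f x) ≠ 0 := by
      simp [hp, hxs]
    have h1 : f '' (F.connectedComponentMk x).supp ⊆ {y | p y = p (f x)} := by
      rintro _ ⟨y, hy, rfl⟩
      exact hconst y x (ConnectedComponent.exact hy)
    have h2 := Set.ncard_le_ncard h1 (Set.toFinite _)
    rw [Set.ncard_image_of_injective _ hfinj] at h2
    have h3 := hpart _ hne
    have h4 := supp_ncard_pos (F.connectedComponentMk x)
    omega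
  have hle : bigOrder F j ≤ s := by
    have h1 : (e ∘ f) '' {x | j ≤ (F.connectedComponentMk x).supp.ncard} ⊆
        (Finset.range s : Finset ℕ) := by
      rintro _ ⟨x, hx, rfl⟩
      simpa using hzero x hx
    have h2 := Set.ncard_le_ncard h1 (Finset.finite_toSet _)
    rwa [Set.ncard_image_of_injective _ (heinj.comp hfinj), Set.ncard_coe_finset,
      Finset.card_range] at h2
  omega

/-- The complete graph on `Fin N` without the edges joining `v` to the elements of `D`. -/
def deletedStar {N : ℕ} (v : Fin N) (D : Set (Fin N)) : SimpleGraph (Fin N) :=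
  (completeGraph (Fin N)).deleteEdges ((fun x => s(v, x)) '' D)

theorem ncard_edgeSet_completeGraph (U : Type*) [Finite U] :
    (completeGraph U).edgeSet.ncard = (Nat.card U).choose 2 := by
  classical
  have := Fintype.ofFinite U
  rw [← coe_edgeFinset, Set.ncard_coe_finset, Nat.card_eq_fintype_card]
  exact card_edgeFinset_top_eq_card_choose_two

theorem ncard_edgeSet_deletedStar {N : ℕ} {v : Fin N} {D : Set (Fin N)} (hv : v ∉ D) :
    (deletedStar v D).edgeSet.ncard + D.ncard = N.choose 2 := by
  have hinj : Function.Injective fun x : Fin N => s(v, x) := fun x y => Sym2.congr_right.1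
  rw [deletedStar, edgeSet_deleteEdges, ← Set.ncard_image_of_injective D hinj,
    Set.ncard_sdiff_add_ncard_of_subset _ (Set.toFinite _), ncard_edgeSet_completeGraph,
    Nat.card_fin]
  rintro _ ⟨x, hx, rfl⟩
  simp only [mem_edgeSet, completeGraph_eq_top, top_adj]
  rintro rfl
  exact hv hx

theorem deletedStar_adj {N : ℕ} {v : Fin N} {D : Set (Fin N)} {x y : Fin N} :
    (deletedStar v D).Adj x y ↔ x ≠ y ∧ ¬ (x = v ∧ y ∈ D) ∧ ¬ (y = v ∧ x ∈ D) := by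
  simp only [deletedStar, deleteEdges_adj, completeGraph_eq_top, top_adj, Set.mem_image,
    Sym2.eq_iff]
  constructor
  · rintro ⟨h1, h2⟩
    refine ⟨h1, fun h => h2 ⟨y, h.2, Or.inl ⟨h.1.symm, rfl⟩⟩,
      fun h => h2 ⟨x, h.2, Or.inr ⟨h.1.symm, rfl⟩⟩⟩
  · rintro ⟨h1, h2, h3⟩
    refine ⟨h1, ?_⟩
    rintro ⟨z, hz, ⟨rfl, rfl⟩ | ⟨rfl, rfl⟩⟩
    exacts [h2 ⟨rfl, hz⟩, h3 ⟨rfl, hz⟩]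

/-- `K_N` with a star of `d` edges removed still arrows the forest, if `N` is large enough. -/
theorem arrows_deletedStar [Finite V] {F : SimpleGraph V} (hF : F.IsAcyclic) {N M d : ℕ}
    {v : Fin N} {D : Set (Fin N)} (hD : D.ncard ≤ d)
    (hN : ∀ K : F.ConnectedComponent,
      (K.supp.ncard - 1) * M + bigOrder F K.supp.ncard ≤ N)
    (hNd : ∀ K : F.ConnectedComponent, d ≤ K.supp.ncard - 2 ∨
      (K.supp.ncard - 1) * M + bigOrder F K.supp.ncard ≤ N - 1) :
    Arrows (deletedStar v D) F (completeGraph (Fin (M + 2))) := by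
  classical
  have : Fintype F.ConnectedComponent := Fintype.ofFinite _
  rw [arrows_completeGraph_iff]
  intro R hR hB
  have hor : ∀ x y, (deletedStar v D).Adj x y → R.Adj x y ∨ (deletedStar v D \ R).Adj x y := by
    intro x y h
    by_cases hr : R.Adj x y
    exacts [Or.inl hr, Or.inr ⟨h, hr⟩]
  obtain ⟨f, hinj, hf, -⟩ := exists_forest_embedding hF R (deletedStar v D \ R) M d v hB
    Finset.univ Finset.univ
    (fun x _ y _ hxy hx hy => hor x y (deletedStar_adj.2 ⟨hxy, fun h => hx h.1, fun h => hy h.1⟩))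
    (by
      refine (Set.ncard_le_ncard ?_ (Set.toFinite D)).trans hD
      rintro x ⟨-, hxv, h1, h2⟩
      by_contra hx
      rcases hor v x (deletedStar_adj.2 ⟨hxv.symm, fun h => hx h.2, fun h => hxv h.1⟩) with h | h
      exacts [h1 h, h2 h])
    (fun K _ => by
      rw [componentDemand, sum_supp_ncard_eq_bigOrder]
      simpa using hN K)
    (fun K _ => by
      rw [componentDemand, sum_supp_ncard_eq_bigOrder]
      simpa [Finset.card_erase_of_mem] using hNd K)
  exact ⟨⟨⟨f, fun {x y} h => hf x y (Finset.mem_univ _) h⟩,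
    fun x y h => hinj (Finset.mem_univ _) (Finset.mem_univ _) h⟩⟩

/-- The value whose maximum over the component orders is the Ramsey number, at `jZero`. -/
def maxValue (F : SimpleGraph V) (M : ℕ) : ℕ :=
  (jZero F (M + 2) - 1) * M + bigOrder F (jZero F (M + 2))

theorem mem_componentOrders [Finite V] {F : SimpleGraph V} {j : ℕ} :
    j ∈ componentOrders F ↔ ∃ K : F.ConnectedComponent, K.supp.ncard = j := by
  rw [componentOrders, Set.mem_ofPred_eq, numComponents, ← Nat.pos_iff_ne_zero, Set.ncard_pos (Set.toFinite _)]
  rfl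

theorem exists_supp_ncard_eq_jZero [Finite V] [Nonempty V] (F : SimpleGraph V) (m : ℕ) :
    ∃ K : F.ConnectedComponent, K.supp.ncard = jZero F m :=
  mem_componentOrders.1 (jZero_isLeast F m).1.1

theorem jZero_pos [Finite V] [Nonempty V] (F : SimpleGraph V) (m : ℕ) : 0 < jZero F m := by
  obtain ⟨K, hK⟩ := exists_supp_ncard_eq_jZero F m
  exact hK ▸ supp_ncard_pos K

theorem value_le_maxValue [Finite V] [Nonempty V] {F : SimpleGraph V} (M : ℕ)
    (K : F.ConnectedComponent) :
    (K.supp.ncard - 1) * M + bigOrder F K.supp.ncard ≤ maxValue F M := by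
  have h := (jZero_isLeast F (M + 2)).1.2 _ (mem_componentOrders.2 ⟨K, rfl⟩)
  rw [forestValue_eq F M _ (supp_ncard_pos K), forestValue_eq F M _ (jZero_pos F _)] at h
  exact_mod_cast h

/-- Equality would make a smaller order a maximiser, against the minimality of j₀. The strictness is
the spare vertex that allows the centre of the star to be dropped. -/
theorem value_lt_maxValue [Finite V] [Nonempty V] {F : SimpleGraph V} {M : ℕ}
    {K : F.ConnectedComponent} (hK : K.supp.ncard < jZero F (M + 2)) :
    (K.supp.ncard - 1) * M + bigOrder F K.supp.ncard < maxValue F M := by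
  by_contra hge
  have hle := (value_le_maxValue M K).antisymm (not_lt.1 hge)
  refine hK.not_ge ((jZero_isLeast F (M + 2)).2 ⟨mem_componentOrders.2 ⟨K, rfl⟩, ?_⟩)
  intro i hi
  refine ((jZero_isLeast F (M + 2)).1.2 i hi).trans (le_of_eq ?_)
  rw [forestValue_eq F M _ (supp_ncard_pos K), forestValue_eq F M _ (jZero_pos F _), hle,
    maxValue]

theorem jZero_le_bigOrder [Finite V] [Nonempty V] (F : SimpleGraph V) (m : ℕ) :
    jZero F m ≤ bigOrder F (jZero F m) := by
  obtain ⟨K, hK⟩ := exists_supp_ncard_eq_jZero F m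
  rw [bigOrder, ← hK]
  refine Set.ncard_le_ncard (fun x hx => ?_) (Set.toFinite _)
  rw [ConnectedComponent.mem_supp_iff] at hx
  simp [hx]

theorem maxValue_le_card [Finite V] [Nonempty V] [Finite U] {F : SimpleGraph V}
    {G : SimpleGraph U} {M : ℕ} (h : Arrows G F (completeGraph (Fin (M + 2)))) :
    maxValue F M ≤ Nat.card U := by
  by_contra hlt
  have h1 := jZero_pos F (M + 2)
  have h2 := jZero_le_bigOrder F (M + 2)
  exact not_arrows_of_card_lt F G (by omega) (not_le.1 hlt) h

/-- At the threshold, a star of `jZero F - 2` edges can be removed. -/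
theorem exists_deletedStar_arrows [Finite V] [Nonempty V] {F : SimpleGraph V} (hF : F.IsAcyclic)
    (M : ℕ) : ∃ (v : Fin (maxValue F M)) (D : Set (Fin (maxValue F M))), v ∉ D ∧
      D.ncard = jZero F (M + 2) - 2 ∧
      Arrows (deletedStar v D) F (completeGraph (Fin (M + 2))) := by
  have h1 := jZero_pos F (M + 2)
  have h2 : jZero F (M + 2) ≤ maxValue F M := (jZero_le_bigOrder F (M + 2)).trans (by
    rw [maxValue]
    omega)
  let v : Fin (maxValue F M) := ⟨0, by omega⟩
  obtain ⟨D, hD, hDc⟩ := Set.exists_subset_card_eq (s := ({v}ᶜ : Set (Fin (maxValue F M))))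
    (n := jZero F (M + 2) - 2) (by
      rw [Set.ncard_compl, Set.ncard_singleton, Nat.card_eq_fintype_card, Fintype.card_fin]
      omega)
  refine ⟨v, D, fun h => hD h rfl, hDc,
    arrows_deletedStar hF hDc.le (value_le_maxValue M) fun K => ?_⟩
  by_cases hK : K.supp.ncard < jZero F (M + 2)
  · right
    have := value_lt_maxValue hK
    omega
  · left
    omega

/-- The Ramsey number of a forest versus a complete graph. -/
theorem ramseyNumber_eq_maxValue [Finite V] [Nonempty V] {F : SimpleGraph V} (hF : F.IsAcyclic)
    (M : ℕ) : ramseyNumber F (completeGraph (Fin (M + 2))) = maxValue F M := by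
  obtain ⟨v, D, -, -, h⟩ := exists_deletedStar_arrows hF M
  refine IsLeast.csInf_eq ⟨⟨v.pos, h.mono fun x y hxy => hxy.ne⟩, ?_⟩
  rintro n ⟨-, hn⟩
  simpa using maxValue_le_card hn

theorem sizeRamseyNumber_le_of_arrows {A : SimpleGraph V} {B : SimpleGraph W} {n : ℕ}
    {G : SimpleGraph (Fin n)} (h : Arrows G A B) : sizeRamseyNumber A B ≤ G.edgeSet.ncard :=
  Nat.sInf_le ⟨n, G, rfl, h⟩

theorem sizeRamseyNumber_forest_le [Finite V] [Nonempty V] {F : SimpleGraph V}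
    (hF : F.IsAcyclic) {m : ℕ} (hm : 2 ≤ m) :
    (sizeRamseyNumber F (completeGraph (Fin m)) : ℤ) ≤
      ((ramseyNumber F (completeGraph (Fin m))).choose 2 : ℤ) - ((jZero F m : ℤ) - 2) := by
  obtain ⟨M, rfl⟩ : ∃ M, m = M + 2 := ⟨m - 2, by omega⟩
  rw [ramseyNumber_eq_maxValue hF]
  obtain ⟨v, D, hv, hD, h⟩ := exists_deletedStar_arrows hF M
  have h1 := sizeRamseyNumber_le_of_arrows h
  have h2 := ncard_edgeSet_deletedStar hv
  -- For j₀ = 1 the truncated `jZero - 2` deletes no edge, while the integer bound is then one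
  -- larger than the binomial.
  omega

end Arrowing

/-! ### Matchings: exact values and the lower bound -/

section Matchings

variable {U : Type*}

theorem matchingGraph_isAcyclic (t : ℕ) : (matchingGraph t).IsAcyclic := by
  rintro u c hc
  cases c with
  | nil => exact hc.ne_nil rfl
  | @cons _ v _ h₁ p =>
    cases p with
    | nil => exact h₁.ne rfl
    | @cons _ w _ h₂ q =>
      -- Each vertex has a single neighbour, so a second step returns along the first edge, which a
      -- cycle cannot repeat.
      have hw : w = u := Prod.ext (h₂.1.symm.trans h₁.1.symm)
        ((Bool.eq_not.2 h₂.2.symm).trans (Bool.eq_not.2 h₁.2).symm)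
      subst hw
      have hnodup := hc.isCircuit.isTrail.edges_nodup
      rw [Walk.edges_cons, Walk.edges_cons, List.nodup_cons] at hnodup
      exact hnodup.1 (by simp [Sym2.eq_swap])

theorem matchingGraph_supp_ncard {t : ℕ} (K : (matchingGraph t).ConnectedComponent) :
    K.supp.ncard = 2 := by
  induction K using ConnectedComponent.ind with
  | _ x =>
  have hconst : ∀ y z, (matchingGraph t).Reachable y z → y.1 = z.1 := by
    rintro y z ⟨w⟩
    induction w with
    | nil => rfl
    | cons h _ ih => exact h.1.trans ih
  have hsupp : ((matchingGraph t).connectedComponentMk x).supp = {x, (x.1, !x.2)} := by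
    ext y
    rw [ConnectedComponent.mem_supp_iff, ConnectedComponent.eq, Set.mem_insert_iff,
      Set.mem_singleton_iff]
    constructor
    · intro h
      have h1 := hconst y x h
      by_cases h2 : y.2 = x.2
      · exact Or.inl (Prod.ext h1 h2)
      · exact Or.inr (Prod.ext h1 (Bool.eq_not.2 h2))
    · rintro (rfl | rfl)
      · exact Reachable.rfl
      · exact Adj.reachable ⟨rfl, by simp⟩
  rw [hsupp, Set.ncard_pair]
  intro h
  simpa using congrArg Prod.snd h

theorem bigOrder_matchingGraph (t : ℕ) : bigOrder (matchingGraph t) 2 = 2 * t := by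
  simp [bigOrder, matchingGraph_supp_ncard, Set.ncard_univ, mul_comm]

theorem jZero_matchingGraph {t : ℕ} (ht : 1 ≤ t) (m : ℕ) : jZero (matchingGraph t) m = 2 := by
  have : NeZero t := ⟨by omega⟩
  obtain ⟨K, hK⟩ := exists_supp_ncard_eq_jZero (matchingGraph t) m
  rw [← hK, matchingGraph_supp_ncard]

theorem maxValue_matchingGraph {t : ℕ} (ht : 1 ≤ t) (M : ℕ) :
    maxValue (matchingGraph t) M = M + 2 * t := by
  rw [maxValue, jZero_matchingGraph ht, bigOrder_matchingGraph]
  omega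

theorem ramseyNumber_matchingGraph {t m : ℕ} (ht : 1 ≤ t) (hm : 2 ≤ m) :
    ramseyNumber (matchingGraph t) (completeGraph (Fin m)) = m + 2 * t - 2 := by
  have : NeZero t := ⟨by omega⟩
  obtain ⟨M, rfl⟩ : ∃ M, m = M + 2 := ⟨m - 2, by omega⟩
  rw [ramseyNumber_eq_maxValue (matchingGraph_isAcyclic t), maxValue_matchingGraph ht]
  omega

theorem sizeRamseyNumber_matchingGraph_le {t m : ℕ} (ht : 1 ≤ t) (hm : 2 ≤ m) :
    sizeRamseyNumber (matchingGraph t) (completeGraph (Fin m)) ≤ (m + 2 * t - 2).choose 2 := by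
  have : NeZero t := ⟨by omega⟩
  have h := sizeRamseyNumber_forest_le (matchingGraph_isAcyclic t) hm
  rw [jZero_matchingGraph ht, ramseyNumber_matchingGraph ht hm] at h
  simpa using h

/-- Removing an independent set from a graph lowers the order of the unavoidable blue clique by
at most one. -/
theorem Arrows.induce_compl_of_isIndepSet {G : SimpleGraph U} {t m : ℕ} {I : Set U}
    (hI : G.IsIndepSet I)
    (h : Arrows G (matchingGraph t) (completeGraph (Fin (m + 1)))) :
    Arrows (G.induce Iᶜ) (matchingGraph t) (completeGraph (Fin m)) := by
  classical
  rw [arrows_completeGraph_iff] at h ⊢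
  intro R hR hfree
  have hRadj : ∀ x y, (R.map (Function.Embedding.subtype (· ∈ Iᶜ))).Adj x y →
      ∃ (hx : x ∈ Iᶜ) (hy : y ∈ Iᶜ), R.Adj ⟨x, hx⟩ ⟨y, hy⟩ := by
    intro x y hxy
    obtain ⟨u, v, huv, rfl, rfl⟩ := (map_adj _ _ _ _).1 hxy
    exact ⟨u.2, v.2, huv⟩
  -- All edges meeting `I` become blue; a blue clique then contains at most one vertex of `I`.
  obtain ⟨f⟩ := h (R.map (Function.Embedding.subtype (· ∈ Iᶜ)))
    (fun x y hxy => by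
      obtain ⟨hx, hy, hxy⟩ := hRadj x y hxy
      exact hR hxy)
    (by
      intro Q hQ
      have hone : (Q.filter (· ∈ I)).card ≤ 1 := by
        rw [Finset.card_le_one]
        intro a ha b hb
        simp only [Finset.mem_filter] at ha hb
        by_contra hab
        exact hI ha.2 hb.2 hab (hQ.isClique ha.1 hb.1 hab).1
      have hsplit := Finset.card_filter_add_card_filter_not (s := Q) (· ∈ I)
      have hcard : m ≤ (Q.subtype (· ∈ Iᶜ)).card := by
        rw [Finset.card_subtype]
        have := hQ.card_eq
        simp only [Set.mem_compl_iff]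
        omega
      refine hfree.mono hcard (Q.subtype (· ∈ Iᶜ)) ⟨?_, rfl⟩
      intro a ha b hb hab
      rw [Finset.mem_coe, Finset.mem_subtype] at ha hb
      obtain ⟨h1, h2⟩ := hQ.isClique ha hb (Subtype.val_injective.ne hab)
      exact ⟨h1, fun hr => h2 ((map_adj _ _ _ _).2 ⟨a, b, hr, rfl, rfl⟩)⟩)
  -- A matching has no isolated vertex, so its red copy cannot touch `I`.
  have hmem : ∀ x, f x ∈ Iᶜ := fun x =>
    (hRadj _ _ (f.toHom.map_adj (show (matchingGraph t).Adj x (x.1, !x.2) from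
      ⟨rfl, by simp⟩))).1
  exact ⟨⟨⟨fun x => ⟨f x, hmem x⟩, fun {x y} hxy => (hRadj _ _ (f.toHom.map_adj hxy)).2.2⟩,
    fun x y hxy => f.injective (congrArg Subtype.val hxy)⟩⟩

/-- Choose for each vertex outside `I` one edge into `I`. These edges are distinct, and none lies in
the induced graph. -/
theorem ncard_edgeSet_induce_compl_add_le [Finite U] {G : SimpleGraph U} {I : Set U}
    (hI : ∀ x ∉ I, ∃ y ∈ I, G.Adj x y) :
    (G.induce Iᶜ).edgeSet.ncard + Nat.card (Iᶜ : Set U) ≤ G.edgeSet.ncard := by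
  choose g hgI hg using fun x : (Iᶜ : Set U) => hI x x.2
  have hinj : Function.Injective fun x : (Iᶜ : Set U) => s((x : U), g x) := by
    intro x y hxy
    rcases Sym2.eq_iff.1 hxy with ⟨h, -⟩ | ⟨h, -⟩
    · exact Subtype.ext h
    · exact (x.2 (h ▸ hgI y)).elim
  rw [← Set.ncard_image_of_injective _ (Sym2.map.injective (Subtype.val_injective (p := (· ∈ Iᶜ)))),
    ← Set.ncard_univ, ← Set.ncard_image_of_injective _ hinj,
    ← Set.ncard_union_eq _ (Set.toFinite _) (Set.toFinite _)]
  · refine Set.ncard_le_ncard ?_ (Set.toFinite _)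
    rintro _ (⟨e, he, rfl⟩ | ⟨x, -, rfl⟩)
    · induction e using Sym2.inductionOn with
      | _ x y => exact he
    · exact hg x
  · rw [Set.disjoint_left]
    rintro _ ⟨e, he, rfl⟩ ⟨x, -, hx⟩
    have h1 : g x ∈ Sym2.map Subtype.val e := hx ▸ Sym2.mem_mk_right _ _
    obtain ⟨y, -, hy⟩ := Sym2.mem_map.1 h1
    exact y.2 (hy ▸ hgI x)

/-- Extend the nonadjacent pair to a maximal independent set; maximality forces every outside vertex
to have a neighbour inside. -/
theorem exists_maximal_isIndepSet_of_not_adj [Finite U] {G : SimpleGraph U} {x y : U}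
    (hxy : x ≠ y) (h : ¬ G.Adj x y) :
    ∃ I : Set U, G.IsIndepSet I ∧ 2 ≤ I.ncard ∧ ∀ z ∉ I, ∃ w ∈ I, G.Adj z w := by
  have hpair : G.IsIndepSet {x, y} := by
    rw [isIndepSet_iff, Set.pairwise_pair]
    exact fun _ => ⟨h, fun h' => h h'.symm⟩
  obtain ⟨I, hI, hmax⟩ := (Set.toFinite {I : Set U | G.IsIndepSet I}).exists_le_maximal hpair
  refine ⟨I, hmax.1, ?_, fun z hz => ?_⟩
  · rw [← Set.ncard_pair hxy]
    exact Set.ncard_le_ncard hI (Set.toFinite _)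
  · by_contra! hno
    refine hz (hmax.2 (y := insert z I) ?_ (Set.subset_insert z I) (Set.mem_insert z I))
    refine (Set.pairwise_insert).2 ⟨hmax.1, fun w hw _ => ⟨hno w hw, fun h => hno w hw h.symm⟩⟩

/-- A lower bound for the number of edges of a graph arrowing `(t K_2, K_{k+2})`, by repeatedly
removing maximal independent sets with at least two vertices until the graph is complete. -/
theorem edge_bound_of_arrows_matchingGraph {t : ℕ} (ht : 1 ≤ t) (k : ℕ) :
    ∀ {U : Type} [Finite U] (G : SimpleGraph U),
      Arrows G (matchingGraph t) (completeGraph (Fin (k + 2))) →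
      (k + 2 * t).choose 2 ≤ G.edgeSet.ncard ∨
        2 * t + 2 * k ≤ Nat.card U ∧ t + 2 * t * k + k * (k - 1) ≤ G.edgeSet.ncard := by
  have : NeZero t := ⟨by omega⟩
  induction k with
  | zero =>
    intro U _ G h
    right
    rw [arrows_completeGraph_iff] at h
    obtain ⟨f⟩ := h G le_rfl (by simp)
    have hfinj : Function.Injective f := f.injective
    constructor
    · simpa [mul_comm] using Nat.card_le_card_of_injective f hfinj
    · have hinj : Function.Injective fun i : Fin t => s(f (i, false), f (i, true)) := by
        intro i j hij
        rcases Sym2.eq_iff.1 hij with ⟨h, -⟩ | ⟨h, -⟩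
        · exact congrArg Prod.fst (hfinj h)
        · simpa using hfinj h
      have h1 : Set.range (fun i : Fin t => s(f (i, false), f (i, true))) ⊆ G.edgeSet := by
        rintro _ ⟨i, rfl⟩
        exact f.toHom.map_adj (show (matchingGraph t).Adj (i, false) (i, true) from
          ⟨rfl, by simp⟩)
      have h2 := Set.ncard_le_ncard h1 (Set.toFinite _)
      rw [← Set.image_univ, Set.ncard_image_of_injective _ hinj, Set.ncard_univ] at h2
      simpa using h2
  | succ k ih =>
    intro U _ G h
    by_cases htop : G = completeGraph U
    · left
      have := maxValue_le_card h
      rw [maxValue_matchingGraph ht] at this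
      rw [htop, ncard_edgeSet_completeGraph]
      exact Nat.choose_le_choose 2 this
    · obtain ⟨x, y, hxy, hnadj⟩ : ∃ x y, x ≠ y ∧ ¬ G.Adj x y := by
        by_contra! hall
        exact htop (eq_top_iff.2 fun x y hxy => hall x y hxy)
      obtain ⟨I, hI, hI2, hdom⟩ := exists_maximal_isIndepSet_of_not_adj hxy hnadj
      have h' := h.induce_compl_of_isIndepSet hI
      have hcard := maxValue_le_card h'
      rw [maxValue_matchingGraph ht] at hcard
      have hedge := ncard_edgeSet_induce_compl_add_le hdom
      have hcompl : I.ncard + Nat.card (Iᶜ : Set U) = Nat.card U := Set.ncard_add_ncard_compl I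
      rcases ih _ h' with h1 | ⟨h1, h2⟩
      -- The remaining graph still has at least `k + 2 * t` vertices, each contributing an edge into
      -- `I`: exactly the increment of the binomial coefficient.
      · left
        have : (k + 1 + 2 * t).choose 2 = (k + 2 * t) + (k + 2 * t).choose 2 := by
          rw [show k + 1 + 2 * t = (k + 2 * t) + 1 by ring, Nat.choose_succ_succ' _ 1,
            Nat.choose_one_right]
        omega
      -- Here at least `2 * t + 2 * k` vertices remain; summing these contributions over the layers
      -- gives the quadratic bound.
      · right
        refine ⟨by omega, ?_⟩
        have : t + 2 * t * (k + 1) + (k + 1) * (k + 1 - 1) =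
            t + 2 * t * k + k * (k - 1) + (2 * t + 2 * k) := by
          cases k with
          | zero => simp
          | succ k =>
            simp only [Nat.add_sub_cancel]
            ring
        omega

theorem le_sizeRamseyNumber_matchingGraph {t m : ℕ} (ht : 1 ≤ t) (hm : 4 * t - 1 ≤ m) :
    (m + 2 * t - 2).choose 2 ≤ sizeRamseyNumber (matchingGraph t) (completeGraph (Fin m)) := by
  have : NeZero t := ⟨by omega⟩
  obtain ⟨k, rfl⟩ : ∃ k, m = k + 1 + 2 := ⟨m - 3, by omega⟩
  obtain ⟨v, D, -, -, hD⟩ := exists_deletedStar_arrows (matchingGraph_isAcyclic t) (k + 1)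
  refine le_csInf ⟨_, _, _, rfl, hD⟩ ?_
  rintro _ ⟨n, G, rfl, hG⟩
  rw [show k + 1 + 2 + 2 * t - 2 = k + 1 + 2 * t by omega]
  rcases edge_bound_of_arrows_matchingGraph ht _ G hG with h | ⟨-, h⟩
  · exact h
  · refine le_trans ?_ h
    rw [Nat.choose_two_right, show k + 1 + 2 * t - 1 = k + 2 * t by omega, Nat.add_sub_cancel]
    refine Nat.div_le_of_le_mul ?_
    obtain ⟨s, rfl⟩ : ∃ s, t = s + 1 := ⟨t - 1, by omega⟩
    have hk : 4 * s ≤ k := by omega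
    -- After cancellation the claim is `4 * t * (t - 1) ≤ k * (k + 1)`, which follows from `k ≥ 4 *
    -- (t - 1)`.
    nlinarith [Nat.mul_le_mul hk hk]

end Matchings

end ForestRamsey

end

theorem mainTheorem6 :
    (∀ {V : Type*} [Finite V] [Nonempty V] (F : SimpleGraph V), F.IsAcyclic →
      ∀ m : ℕ, 3 ≤ m →
        (ForestRamsey.sizeRamseyNumber F (completeGraph (Fin m)) : ℤ) ≤
          ((ForestRamsey.ramseyNumber F (completeGraph (Fin m))).choose 2 : ℤ) -
            ((ForestRamsey.jZero F m : ℤ) - 2)) ∧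
    (∀ t m : ℕ, 1 ≤ t → 3 ≤ m →
      ForestRamsey.jZero (ForestRamsey.matchingGraph t) m = 2 ∧
      ForestRamsey.ramseyNumber (ForestRamsey.matchingGraph t) (completeGraph (Fin m)) =
        m + 2 * t - 2 ∧
      ForestRamsey.sizeRamseyNumber (ForestRamsey.matchingGraph t) (completeGraph (Fin m)) ≤
        (m + 2 * t - 2).choose 2) ∧
    (∀ t m : ℕ, 1 ≤ t → 4 * t - 1 ≤ m →
      ForestRamsey.sizeRamseyNumber (ForestRamsey.matchingGraph t) (completeGraph (Fin m)) =
        (m + 2 * t - 2).choose 2 ∧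
      (ForestRamsey.sizeRamseyNumber (ForestRamsey.matchingGraph t)
          (completeGraph (Fin m)) : ℤ) =
        ((ForestRamsey.ramseyNumber (ForestRamsey.matchingGraph t)
            (completeGraph (Fin m))).choose 2 : ℤ) -
          ((ForestRamsey.jZero (ForestRamsey.matchingGraph t) m : ℤ) - 2)) := by
  refine ⟨fun F hF m hm => ForestRamsey.sizeRamseyNumber_forest_le hF (by omega),
    fun t m ht hm => ⟨ForestRamsey.jZero_matchingGraph ht m,
      ForestRamsey.ramseyNumber_matchingGraph ht (by omega),
      ForestRamsey.sizeRamseyNumber_matchingGraph_le ht (by omega)⟩, fun t m ht hm => ?_⟩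
  have h := (ForestRamsey.sizeRamseyNumber_matchingGraph_le ht (by omega)).antisymm
    (ForestRamsey.le_sizeRamseyNumber_matchingGraph ht hm)
  refine ⟨h, ?_⟩
  rw [h, ForestRamsey.ramseyNumber_matchingGraph ht (by omega),
    ForestRamsey.jZero_matchingGraph ht m]
  simp
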